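/- There is a universal constant $c>0$ such that the following holds. Let $(T,\rho)$ be a compact metric space of Minkowski dimension $d\in[1,\infty)$, i.e. $$\lim_{x\downarrow 0}\frac{\log N(T,\rho,x)}{\log(1/x)}=d,$$ where $N(T,\rho,x)$ is the smallest number of closed balls of radius $x$ with centers in $T$ whose union is $T$. Then, for every $\varepsilon\in(0,c)$, $$\lim_{n\to\infty}\ \inf_{\mathcal A}\ \sup_{X}\ \frac{\log\big(\mathbb E\,W_1(\mu_Y,\mu_X)\big)}{\log n}=-\frac1d .$$ Here the supremum is over all input data $X=(X_1,\dots,X_n)\in T^n$; the infimum is over all $\varepsilon$-differentially private randomized algorithms $\mathcal A$ that take $X\in T^n$ as input and return synthetic data $Y=\mathcal A(X)=(Y_1,\dots,Y_m)\in T^m$ for some $m\ge 1$ (so $\mathcal A$ takes values in $\bigcup_{m\ge1}T^m$). Such an algorithm assigns to each $X\in T^n$ the distribution of a random element of $\bigcup_{m\ge 1}T^m$, and it is $\varepsilon$-differentially private if $\Pr\{\mathcal A(X)\in S\}\le e^{\varepsilon}\,\Pr\{\mathcal A(X')\in S\}$ for every measurable $S$ and all $X,X'\in T^n$ that differ in at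 most one entry. Moreover $\mu_X=\frac1n\sum_{i=1}^n\delta_{X_i}$ and $\mu_Y=\frac1m\sum_{i=1}^m\delta_{Y_i}$ are the empirical measures, $W_1(\mu,\nu)=\inf_\gamma\int_{T\times T}\rho(x,y)\,d\gamma(x,y)$ is the Wasserstein distance (the infimum is over all couplings $\gamma$ of $\mu$ and $\nu$), the expectation is over the randomness of $\mathcal A$, and $\log 0=-\infty$. -/

import Mathlib

open MeasureTheory Filter Topology
open scoped ENNReal NNReal

noncomputable section

namespace SyntheticPrivacy

/-- The metric space `T` has Minkowski dimension `d`: `log N(T, x) / log (1 / x) → d` as `x ↓ 0`,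
where `N(T, x)` is the least number of closed balls of radius `x` centred in `T` that cover `T`.
In a compact space `N(T, x)` is finite for every `x > 0`, so that `toNat` loses nothing. -/
def HasMinkowskiDim (T : Type*) [MetricSpace T] (d : ℝ) : Prop :=
  Tendsto
    (fun x : ℝ≥0 =>
      Real.log ((Metric.coveringNumber x (Set.univ : Set T)).toNat : ℝ) / Real.log (1 / (x : ℝ)))
    (𝓝[>] 0) (𝓝 d)

/-- The empirical measure `(1/m) ∑ i, δ_{X i}`. -/
def empiricalMeasure {T : Type*} [MeasurableSpace T] {m : ℕ} (X : Fin m → T) : Measure T :=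
  (m : ℝ≥0∞)⁻¹ • ∑ i, Measure.dirac (X i)

/-- `γ` is a coupling of `μ` and `ν`. It is a probability measure as soon as `μ` or `ν` is one. -/
def IsCoupling {T : Type*} [MeasurableSpace T] (γ : Measure (T × T)) (μ ν : Measure T) : Prop :=
  γ.map Prod.fst = μ ∧ γ.map Prod.snd = ν

/-- The Wasserstein 1-distance: the least cost of a coupling, as an extended nonnegative real. -/
def wasserstein {T : Type*} [MetricSpace T] [MeasurableSpace T] (μ ν : Measure T) : ℝ≥0∞ :=
  ⨅ (γ : Measure (T × T)) (_ : IsCoupling γ μ ν), ∫⁻ p, edist p.1 p.2 ∂γ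

/-- Finite nonempty data sets `(Y_1, …, Y_m)`, `m ≥ 1`, i.e. the disjoint union of the `T ^ m`,
with the disjoint-union σ-algebra of the product σ-algebras. -/
abbrev SyntheticData (T : Type*) : Type _ := Σ m : ℕ+, (Fin (m : ℕ) → T)

/-- A randomized algorithm on data sets of `n` points with values in a measurable space `E`: it
assigns to each input the probability distribution of its output. -/
abbrev RandomizedAlgorithm (T : Type*) (n : ℕ) (E : Type*) [MeasurableSpace E] : Type _ :=
  (Fin n → T) → ProbabilityMeasure E

open Classical in
/-- `ε`-differential privacy: whenever two inputs differ in at most one entry, the probabilities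
of each measurable event differ by a factor of at most `exp ε`. -/
def IsDifferentiallyPrivate {T : Type*} {n : ℕ} {E : Type*} [MeasurableSpace E] (ε : ℝ)
    (A : RandomizedAlgorithm T n E) : Prop :=
  ∀ X X' : Fin n → T, hammingDist X X' ≤ 1 → ∀ S : Set E, MeasurableSet S →
    (A X : Measure E) S ≤ ENNReal.ofReal (Real.exp ε) * (A X' : Measure E) S

/-- The expected error `E W₁(μ_Y, μ_X)`, where `Y` is the random output on input `X`. -/
def expectedError {T : Type*} [MetricSpace T] [MeasurableSpace T] {n : ℕ}
    (A : RandomizedAlgorithm T n (SyntheticData T)) (X : Fin n → T) : ℝ≥0∞ :=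
  ∫⁻ Y, wasserstein (empiricalMeasure Y.2) (empiricalMeasure X) ∂(A X : Measure (SyntheticData T))

/-- `inf_A sup_X log (E W₁(μ_Y, μ_X)) / log n` over the `ε`-differentially private algorithms `A`
and the inputs `X` of size `n`, computed in the extended reals with `log 0 = -∞`. -/
def minimaxLogError (T : Type*) [MetricSpace T] [MeasurableSpace T] (ε : ℝ) (n : ℕ) : EReal :=
  ⨅ (A : RandomizedAlgorithm T n (SyntheticData T)) (_ : IsDifferentiallyPrivate ε A),
    ⨆ X : Fin n → T, ENNReal.log (expectedError A X) / ((Real.log n : ℝ) : EReal)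

end SyntheticPrivacy

end

noncomputable section

namespace SyntheticPrivacy

/-! Lower bound. At scale `x = n ^ (-t)` with `t > 1 / d`, the space contains `n + 1` points that
are `x`-separated. One of them is a dummy; the others encode `n` bits, entry `i` of the data being
either its own point or the dummy. Hat functions of disjoint supports around the points read the
bits off a measure, and a coupling of cost `W` controls the total reading error by `2 * W`. Flipping
a bit changes one entry, so privacy makes the output law almost the same for both values of the bit;
averaged over all bit strings, each bit is misread by a constant fraction of its mass. Summed over
the bits this gives an error of order `x` (`exists_le_expectedError`), for every `ε > 0`.

Upper bound. Nets at the dyadic scales `2 ^ i / 2 ^ J` form a tree. Two data sets can be matched so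
well at all levels simultaneously (`exists_perm_card_mismatch_le`) that `W₁` is at most the finest
scale plus the weighted `ℓ¹` distance of their tree histograms (`wasserstein_le_sum_occurrences`).
The algorithm adds truncated two-sided geometric noise to every count and outputs a data set whose
counts are closest to the noisy ones (`exists_algorithm_of_counts`). Scale `u` contributes about `u
* u ^ (-d) / n`, which for `d ≥ 1` is worst at the finest scale; taking `2 ^ J` close to `n ^ (1 /
d)` balances this with `2 ^ (-J)`, up to powers of `log n` and an arbitrarily small loss in the
exponent. -/

open Classical in
lemma IsDifferentiallyPrivate.measure_le {n : ℕ} {E : Type*} [MeasurableSpace E] {ε : ℝ}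
    {A : RandomizedAlgorithm T n E} (hA : IsDifferentiallyPrivate ε A) {X X' : Fin n → T}
    (h : hammingDist X X' ≤ 1) :
    (A X : Measure E) ≤ ENNReal.ofReal (Real.exp ε) • (A X' : Measure E) := by
  refine Measure.le_iff.2 fun S hS => ?_
  have := hA X X' h S hS
  simpa using this

/-! ### Integration against empirical measures and couplings. -/

section Basic

variable {T : Type*} [MeasurableSpace T]

lemma lintegral_empiricalMeasure {m : ℕ} (X : Fin m → T) {f : T → ℝ≥0∞} (hf : Measurable f) :
    ∫⁻ x, f x ∂(empiricalMeasure X) = (m : ℝ≥0∞)⁻¹ * ∑ i, f (X i) := by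
  rw [empiricalMeasure, lintegral_smul_measure, lintegral_finsetSum_measure, smul_eq_mul]
  simp [lintegral_dirac' _ hf]

lemma IsCoupling.lintegral_fst {γ : Measure (T × T)} {μ ν : Measure T} (h : IsCoupling γ μ ν)
    {f : T → ℝ≥0∞} (hf : Measurable f) : ∫⁻ p, f p.1 ∂γ = ∫⁻ x, f x ∂μ := by
  rw [← h.1, lintegral_map hf measurable_fst]

lemma IsCoupling.lintegral_snd {γ : Measure (T × T)} {μ ν : Measure T} (h : IsCoupling γ μ ν)
    {f : T → ℝ≥0∞} (hf : Measurable f) : ∫⁻ p, f p.2 ∂γ = ∫⁻ x, f x ∂ν := by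
  rw [← h.2, lintegral_map hf measurable_snd]

lemma measurable_sigma_lintegral_empiricalMeasure {f : T → ℝ≥0∞} (hf : Measurable f) :
    Measurable fun Y : SyntheticData T => ∫⁻ x, f x ∂(empiricalMeasure Y.2) := by
  intro s hs
  refine MeasurableSpace.measurableSet_iInf.2 fun m => ?_
  change MeasurableSet ((fun Y : Fin (m : ℕ) → T => ∫⁻ x, f x ∂(empiricalMeasure Y)) ⁻¹' s)
  simp_rw [lintegral_empiricalMeasure _ hf]
  refine Measurable.const_mul ?_ _ hs
  exact Finset.measurable_sum _ fun i _ => hf.comp (measurable_pi_apply i)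

end Basic

/-! ### Hat functions with disjoint supports as witnesses for the Wasserstein distance. -/

section Hat

variable {T : Type*} [MetricSpace T]

/-- The hat function of height `r` and radius `r` centred at `z`. -/
def hat (r : ℝ) (z x : T) : ℝ≥0∞ := ENNReal.ofReal (r - dist x z)

lemma hat_self (r : ℝ) (z : T) : hat r z z = ENNReal.ofReal r := by simp [hat]

lemma hat_eq_zero {r : ℝ} {z x : T} (h : r ≤ dist x z) : hat r z x = 0 := by
  simp [hat, h]

lemma hat_le_add_edist (r : ℝ) (z x y : T) : hat r z x ≤ hat r z y + edist x y := by
  rw [hat, hat, edist_dist]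
  refine le_trans (ENNReal.ofReal_le_ofReal ?_) ENNReal.ofReal_add_le
  linarith [dist_triangle y x z, dist_comm x y]

open Classical in
/-- A bound for the oscillation of a hat function between `p.1` and `p.2`. -/
def hatCost (r : ℝ) (z : T) (p : T × T) : ℝ≥0∞ :=
  (if dist p.1 z < r then edist p.1 p.2 else 0) + (if dist p.2 z < r then edist p.1 p.2 else 0)

/-- The hat is 1-Lipschitz and vanishes outside its ball, so transport is charged to `z` only when
an endpoint is in the ball of `z`. This localisation is what lets the costs of many hats be added.
-/
lemma hat_fst_le (r : ℝ) (z : T) (p : T × T) : hat r z p.1 ≤ hat r z p.2 + hatCost r z p := by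
  by_cases h : dist p.1 z < r
  · refine (hat_le_add_edist r z p.1 p.2).trans ?_
    gcongr
    simp [hatCost, h]
  · rw [hat_eq_zero (not_lt.1 h)]; exact zero_le

lemma hat_snd_le (r : ℝ) (z : T) (p : T × T) : hat r z p.2 ≤ hat r z p.1 + hatCost r z p := by
  by_cases h : dist p.2 z < r
  · refine (hat_le_add_edist r z p.2 p.1).trans ?_
    gcongr
    simp [hatCost, h, edist_comm p.2 p.1]
  · rw [hat_eq_zero (not_lt.1 h)]; exact zero_le

-- The open balls of radius `r` about the centres are disjoint, so at most one summand is nonzero.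
open Classical in
lemma sum_ite_dist_lt_le {ι : Type*} [Fintype ι] {r : ℝ} {z : ι → T}
    (hz : Pairwise fun i j => 2 * r ≤ dist (z i) (z j)) (x : T) (e : ℝ≥0∞) :
    ∑ i, (if dist x (z i) < r then e else 0) ≤ e := by
  by_cases h : ∃ i, dist x (z i) < r
  · obtain ⟨i, hi⟩ := h
    rw [Finset.sum_eq_single i]
    · simp [hi]
    · intro j _ hj
      rw [if_neg]
      intro h'
      have := hz hj
      linarith [dist_triangle_left (z j) (z i) x]
    · simp
  · push Not at h
    simp [fun i => not_lt.2 (h i)]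

lemma sum_hatCost_le {ι : Type*} [Fintype ι] {r : ℝ} {z : ι → T}
    (hz : Pairwise fun i j => 2 * r ≤ dist (z i) (z j)) (p : T × T) :
    ∑ i, hatCost r (z i) p ≤ 2 * edist p.1 p.2 := by
  simp only [hatCost, Finset.sum_add_distrib, two_mul]
  exact add_le_add (sum_ite_dist_lt_le hz _ _) (sum_ite_dist_lt_le hz _ _)

variable [MeasurableSpace T] [BorelSpace T]

lemma measurable_hat (r : ℝ) (z : T) : Measurable (hat r z) := by
  unfold hat; fun_prop

variable [CompactSpace T]

lemma measurable_hatCost (r : ℝ) (z : T) : Measurable (hatCost r z) := by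
  unfold hatCost
  refine Measurable.add ?_ ?_
  · exact Measurable.ite (measurableSet_lt (by fun_prop) measurable_const) (by fun_prop) measurable_const
  · exact Measurable.ite (measurableSet_lt (by fun_prop) measurable_const) (by fun_prop) measurable_const

/-- Separated hat functions detect the Wasserstein distance. -/
lemma sum_hat_error_le_wasserstein {ι : Type*} [Fintype ι] {r : ℝ} {z : ι → T}
    (hz : Pairwise fun i j => 2 * r ≤ dist (z i) (z j)) (μ ν : Measure T) (F : ι → ℝ≥0∞)
    (hF : ∀ i, F i ≤ ∫⁻ x, hat r (z i) x ∂μ - ∫⁻ x, hat r (z i) x ∂ν ∨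
      F i ≤ ∫⁻ x, hat r (z i) x ∂ν - ∫⁻ x, hat r (z i) x ∂μ) :
    ∑ i, F i ≤ 2 * wasserstein μ ν := by
  rw [wasserstein, ENNReal.mul_iInf_of_ne (by simp) (by simp)]
  refine le_iInf fun γ => ?_
  rw [ENNReal.mul_iInf_of_ne (by simp) (by simp)]
  refine le_iInf fun hγ => ?_
  calc ∑ i, F i ≤ ∑ i, ∫⁻ p, hatCost r (z i) p ∂γ := by
        refine Finset.sum_le_sum fun i _ => ?_
        have hm := measurable_hat r (z i)
        rcases hF i with h | h
        · refine h.trans (tsub_le_iff_left.2 ?_)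
          rw [← hγ.lintegral_fst hm, ← hγ.lintegral_snd hm,
            ← lintegral_add_left (f := fun p : T × T => hat r (z i) p.2) (by fun_prop)]
          exact lintegral_mono fun p => hat_fst_le _ _ p
        · refine h.trans (tsub_le_iff_left.2 ?_)
          rw [← hγ.lintegral_fst hm, ← hγ.lintegral_snd hm,
            ← lintegral_add_left (f := fun p : T × T => hat r (z i) p.1) (by fun_prop)]
          exact lintegral_mono fun p => hat_snd_le _ _ p
    _ = ∫⁻ p, ∑ i, hatCost r (z i) p ∂γ :=
        (lintegral_finsetSum _ fun i _ => measurable_hatCost _ _).symm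
    _ ≤ ∫⁻ p, 2 * edist p.1 p.2 ∂γ := lintegral_mono fun p => sum_hatCost_le hz p
    _ = 2 * ∫⁻ p, edist p.1 p.2 ∂γ := lintegral_const_mul _ (by fun_prop)

end Hat

/-! ### Lower bound: privacy prevents reading single bits. -/

section LowerBound

variable {T : Type*}

/-- The data set that encodes the bits `b`: entry `i` is `z (i + 1)` or `z 0`. -/
def bitData {n : ℕ} (z : Fin (n + 1) → T) (b : Fin n → Bool) (i : Fin n) : T :=
  if b i then z i.succ else z 0

/-- Changing a single bit. -/
def flipBit {n : ℕ} (i : Fin n) (b : Fin n → Bool) : Fin n → Bool := Function.update b i (!b i)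

lemma flipBit_involutive {n : ℕ} (i : Fin n) : Function.Involutive (flipBit i) := by
  intro b; ext j; simp [flipBit]

lemma hammingDist_bitData_flipBit {n : ℕ} [DecidableEq T] (z : Fin (n + 1) → T) (i : Fin n)
    (b : Fin n → Bool) : hammingDist (bitData z b) (bitData z (flipBit i b)) ≤ 1 := by
  rw [hammingDist]
  refine (Finset.card_le_card (t := {i}) fun j hj => ?_).trans (by simp)
  by_contra hji
  simp only [Finset.mem_singleton] at hji
  simp only [Finset.mem_filter, Finset.mem_univ, true_and] at hj
  exact hj (by rw [bitData, bitData, flipBit, Function.update_of_ne hji])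

variable [MetricSpace T] [MeasurableSpace T]

/-- The error in reading off the bit `b i` from a measure by means of a hat function. -/
def bitLoss {n : ℕ} (r : ℝ) (z : Fin (n + 1) → T) (b : Fin n → Bool) (i : Fin n)
    (μ : Measure T) : ℝ≥0∞ :=
  if b i then (n : ℝ≥0∞)⁻¹ * ENNReal.ofReal r - ∫⁻ x, hat r (z i.succ) x ∂μ
  else ∫⁻ x, hat r (z i.succ) x ∂μ

/-- One measure cannot serve both values of a bit: with `h` the hat integral and `v` the mass of a
set bit, the two losses are `v - h` (truncated) and `h`. -/
lemma le_bitLoss_add_bitLoss_flipBit {n : ℕ} (r : ℝ) (z : Fin (n + 1) → T) (b : Fin n → Bool)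
    (i : Fin n) (μ : Measure T) :
    (n : ℝ≥0∞)⁻¹ * ENNReal.ofReal r ≤ bitLoss r z b i μ + bitLoss r z (flipBit i b) i μ := by
  by_cases h : b i
  · simpa [bitLoss, flipBit, h] using
      le_tsub_add (a := ∫⁻ x, hat r (z i.succ) x ∂μ) (b := (n : ℝ≥0∞)⁻¹ * ENNReal.ofReal r)
  · simpa [bitLoss, flipBit, h] using
      le_add_tsub (b := ∫⁻ x, hat r (z i.succ) x ∂μ) (a := (n : ℝ≥0∞)⁻¹ * ENNReal.ofReal r)

variable [BorelSpace T]

/-- Only entry `i` can ever reach the ball of `z i.succ`; the dummy `z 0` lies outside all tested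
balls. -/
lemma lintegral_hat_bitData {n : ℕ} {r : ℝ} (hr : 0 ≤ r) {z : Fin (n + 1) → T}
    (hz : Pairwise fun i j => 2 * r ≤ dist (z i) (z j)) (b : Fin n → Bool) (i : Fin n) :
    ∫⁻ x, hat r (z i.succ) x ∂(empiricalMeasure (bitData z b)) =
      if b i then (n : ℝ≥0∞)⁻¹ * ENNReal.ofReal r else 0 := by
  rw [lintegral_empiricalMeasure _ (measurable_hat _ _)]
  have hoff : ∀ k, k ≠ i.succ → hat r (z i.succ) (z k) = 0 := fun k hk =>
    hat_eq_zero (by have := hz hk; linarith)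
  rw [Finset.sum_eq_single i]
  · by_cases h : b i
    · simp [bitData, h, hat_self]
    · simp [bitData, h, hoff 0 (Fin.succ_ne_zero i).symm]
  · intro j _ hj
    by_cases h : b j
    · simp only [bitData, h, if_true]
      exact hoff _ (by simpa using hj)
    · simp [bitData, h, hoff 0 (Fin.succ_ne_zero i).symm]
  · simp

lemma measurable_bitLoss {n : ℕ} (r : ℝ) (z : Fin (n + 1) → T) (b : Fin n → Bool) (i : Fin n) :
    Measurable fun Y : SyntheticData T => bitLoss r z b i (empiricalMeasure Y.2) := by
  have := measurable_sigma_lintegral_empiricalMeasure (measurable_hat r (z i.succ))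
  by_cases h : b i
  · simp only [bitLoss, h, if_true]
    exact measurable_const.sub this
  · simpa [bitLoss, h] using this

variable [CompactSpace T]

lemma sum_bitLoss_le_wasserstein {n : ℕ} {r : ℝ} (hr : 0 ≤ r) {z : Fin (n + 1) → T}
    (hz : Pairwise fun i j => 2 * r ≤ dist (z i) (z j)) (b : Fin n → Bool) (μ : Measure T) :
    ∑ i, bitLoss r z b i μ ≤ 2 * wasserstein μ (empiricalMeasure (bitData z b)) := by
  refine sum_hat_error_le_wasserstein (r := r) (z := fun i : Fin n => z i.succ)
    (fun i j hij => hz (by simpa using hij)) _ _ _ fun i => ?_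
  rw [lintegral_hat_bitData hr hz]
  by_cases h : b i <;> simp [bitLoss, h]

/-- A private algorithm cannot be accurate on data sets from a large separated set. -/
theorem exists_le_expectedError {n : ℕ} (hn : n ≠ 0) {ε : ℝ} (hε : 0 ≤ ε)
    {A : RandomizedAlgorithm T n (SyntheticData T)} (hA : IsDifferentiallyPrivate ε A)
    {r : ℝ} (hr : 0 ≤ r) {z : Fin (n + 1) → T}
    (hz : Pairwise fun i j => 2 * r ≤ dist (z i) (z j)) :
    ∃ X, ENNReal.ofReal r ≤ 4 * ENNReal.ofReal (Real.exp ε) * expectedError A X := by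
  classical
  set K := ENNReal.ofReal (Real.exp ε) with hK
  have hK1 : 1 ≤ K := by
    rw [hK, ENNReal.one_le_ofReal]; exact Real.one_le_exp hε
  set v : ℝ≥0∞ := (n : ℝ≥0∞)⁻¹ * ENNReal.ofReal r with hv
  set L : (Fin n → Bool) → Fin n → ℝ≥0∞ := fun b i =>
    ∫⁻ Y, bitLoss r z b i (empiricalMeasure Y.2) ∂(A (bitData z b) : Measure (SyntheticData T))
    with hL
  -- Both losses are evaluated under the same output law; privacy then moves the second one to the
  -- law of the flipped input at the price `K`.
  have hpair : ∀ b i, v ≤ K * (L b i + L (flipBit i b) i) := by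
    intro b i
    have h1 : L b i ≤ K * L b i := by
      calc L b i = 1 * L b i := (one_mul _).symm
        _ ≤ K * L b i := by gcongr
    have h2 : ∫⁻ Y, bitLoss r z (flipBit i b) i (empiricalMeasure Y.2)
        ∂(A (bitData z b) : Measure (SyntheticData T)) ≤ K * L (flipBit i b) i := by
      rw [hL, ← smul_eq_mul, ← lintegral_smul_measure]
      exact lintegral_mono' (hA.measure_le (hammingDist_bitData_flipBit z i b)) le_rfl
    calc v = ∫⁻ _, v ∂(A (bitData z b) : Measure (SyntheticData T)) := by simp
      _ ≤ ∫⁻ Y, (bitLoss r z b i (empiricalMeasure Y.2) +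
            bitLoss r z (flipBit i b) i (empiricalMeasure Y.2))
            ∂(A (bitData z b) : Measure (SyntheticData T)) :=
          lintegral_mono fun Y => le_bitLoss_add_bitLoss_flipBit r z b i _
      _ = L b i + _ := lintegral_add_left (measurable_bitLoss r z b i) _
      _ ≤ K * L b i + K * L (flipBit i b) i := add_le_add h1 h2
      _ = _ := (mul_add _ _ _).symm
  -- Flipping bit `i` permutes the bit strings, so both halves of `hpair` have the same sum over
  -- `b`.
  have hbits : ∀ i, ∑ _b : Fin n → Bool, v ≤ 2 * K * ∑ b, L b i := by
    intro i
    calc ∑ _b : Fin n → Bool, v ≤ ∑ b, K * (L b i + L (flipBit i b) i) :=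
          Finset.sum_le_sum fun b _ => hpair b i
      _ = K * (∑ b, L b i + ∑ b, L (flipBit i b) i) := by
          rw [← Finset.mul_sum, Finset.sum_add_distrib]
      _ = 2 * K * ∑ b, L b i := by
          rw [(flipBit_involutive i).bijective.sum_comp (fun b => L b i)]; ring
  have herr : ∀ b, ∑ i, L b i ≤ 2 * expectedError A (bitData z b) := by
    intro b
    rw [hL, ← lintegral_finsetSum _ fun i _ => measurable_bitLoss r z b i, expectedError,
      ← lintegral_const_mul' _ _ (by simp)]
    exact lintegral_mono fun Y => sum_bitLoss_le_wasserstein hr hz b _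
  have hsum : ∑ _b : Fin n → Bool, ENNReal.ofReal r ≤
      ∑ b, 4 * K * expectedError A (bitData z b) := by
    calc ∑ _b : Fin n → Bool, ENNReal.ofReal r = ∑ _b : Fin n → Bool, ∑ _i : Fin n, v := by
          refine Finset.sum_congr rfl fun b _ => ?_
          rw [Finset.sum_const, Finset.card_univ, Fintype.card_fin, nsmul_eq_mul, hv, ← mul_assoc,
            ENNReal.mul_inv_cancel (by simpa using hn) (by simp), one_mul]
      _ = ∑ _i : Fin n, ∑ _b : Fin n → Bool, v := Finset.sum_comm
      _ ≤ ∑ i, 2 * K * ∑ b, L b i := Finset.sum_le_sum fun i _ => hbits i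
      _ = 2 * K * ∑ b, ∑ i, L b i := by rw [← Finset.mul_sum, Finset.sum_comm]
      _ ≤ 2 * K * ∑ b, 2 * expectedError A (bitData z b) := by
          gcongr with b; exact herr b
      _ = _ := by rw [← Finset.mul_sum, ← Finset.mul_sum]; ring
  by_contra! hlt
  exact hsum.not_gt (ENNReal.sum_lt_sum_of_nonempty Finset.univ_nonempty fun b _ => hlt _)

end LowerBound

/-! ### Matching two data sets at all levels of a tree at once. -/

section Matching

lemma sum_add_eq_sum_add_of_eq_off_pair {ι : Type*} [Fintype ι] [DecidableEq ι] {k l : ι}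
    (hkl : k ≠ l) {f f' : ι → ℕ} (h : ∀ i, i ≠ k → i ≠ l → f i = f' i) :
    ∑ i, f i + (f' k + f' l) = ∑ i, f' i + (f k + f l) := by
  have key : ∀ u : ι → ℕ, ∑ i, u i = u k + (u l + ∑ i ∈ (Finset.univ.erase k).erase l, u i) := by
    intro u
    rw [Finset.add_sum_erase _ _ (Finset.mem_erase.2 ⟨hkl.symm, Finset.mem_univ _⟩),
      Finset.add_sum_erase _ _ (Finset.mem_univ _)]
  have hrest : ∑ i ∈ (Finset.univ.erase k).erase l, f i =
      ∑ i ∈ (Finset.univ.erase k).erase l, f' i := by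
    refine Finset.sum_congr rfl fun i hi => ?_
    simp only [Finset.mem_erase, Finset.mem_univ, and_true] at hi
    exact h i hi.2 hi.1
  rw [key f, key f', hrest]
  ring

open Classical in
/-- The number of entries of `u` equal to `C`. -/
def occurrences {n : ℕ} {β : Type*} (u : Fin n → β) (C : β) : ℕ := (Finset.univ.filter (u · = C)).card

lemma occurrences_comp_perm {n : ℕ} {β : Type*} (u : Fin n → β) (σ : Equiv.Perm (Fin n)) (C : β) :
    occurrences (u ∘ σ) C = occurrences u C := by
  classical
  rw [occurrences, occurrences]
  refine Finset.card_bij (fun k _ => σ k) ?_ ?_ ?_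
  · intro k hk; simpa using hk
  · intro k _ l _ h; simpa using h
  · intro k hk; exact ⟨σ.symm k, by simpa using hk, by simp⟩

open Classical in
/-- If more entries mismatch than the histograms require, two mismatched pairs can be merged. -/
lemma exists_mismatch_pair {n : ℕ} {β : Type*} {S : Finset β} {u v : Fin n → β}
    (hu : ∀ k, u k ∈ S)
    (h : ∑ C ∈ S, |(occurrences u C : ℤ) - occurrences v C| <
      (Finset.univ.filter fun k => u k ≠ v k).card) :
    ∃ k l, u k = v l ∧ u k ≠ v k ∧ u l ≠ v l := by
  have hcard : ((Finset.univ.filter fun k => u k ≠ v k).card : ℤ) =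
      ∑ C ∈ S, ((Finset.univ.filter fun k => u k = C ∧ v k ≠ C).card : ℤ) := by
    rw [Finset.card_eq_sum_card_fiberwise (f := u) (t := S) (fun k _ => hu k)]
    push_cast
    refine Finset.sum_congr rfl fun C _ => ?_
    congr 2
    ext k
    simp only [Finset.mem_filter, Finset.mem_univ, true_and]
    constructor
    · rintro ⟨h1, rfl⟩; exact ⟨rfl, h1.symm⟩
    · rintro ⟨rfl, h1⟩; exact ⟨h1.symm, rfl⟩
  rw [hcard] at h
  -- For this `C`, entries with `u = C ≠ v` outnumber the difference of the two counts. After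
  -- cancelling the common entries, that difference is the difference of the two one-sided mismatch
  -- numbers, so there is also an entry with `v = C ≠ u`.
  obtain ⟨C, -, hC⟩ := Finset.exists_lt_of_sum_lt h
  have e1 : occurrences u C = (Finset.univ.filter fun k => u k = C ∧ v k = C).card +
      (Finset.univ.filter fun k => u k = C ∧ v k ≠ C).card := by
    rw [occurrences, ← Finset.card_filter_add_card_filter_not (fun k => v k = C), Finset.filter_filter,
      Finset.filter_filter]
  have e2 : occurrences v C = (Finset.univ.filter fun k => u k = C ∧ v k = C).card +
      (Finset.univ.filter fun k => v k = C ∧ u k ≠ C).card := by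
    rw [occurrences, ← Finset.card_filter_add_card_filter_not (fun k => u k = C), Finset.filter_filter,
      Finset.filter_filter]
    congr 3
    ext k; exact and_comm
  have hle := le_abs_self ((occurrences u C : ℤ) - occurrences v C)
  have hnn := abs_nonneg ((occurrences u C : ℤ) - occurrences v C)
  have p1 : 0 < (Finset.univ.filter fun k => u k = C ∧ v k ≠ C).card := by omega
  have p2 : 0 < (Finset.univ.filter fun k => v k = C ∧ u k ≠ C).card := by omega
  obtain ⟨k, hk⟩ := Finset.card_pos.1 p1
  obtain ⟨l, hl⟩ := Finset.card_pos.1 p2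
  simp only [Finset.mem_filter, Finset.mem_univ, true_and] at hk hl
  exact ⟨k, l, hk.1.trans hl.1.symm, by rw [hk.1]; exact hk.2.symm, by rw [hl.1]; exact hl.2⟩

open Classical in
/-- Two families of points of a tree can be matched optimally at all levels simultaneously. -/
theorem exists_perm_card_mismatch_le {n J : ℕ} {α β : Type*} {g : ℕ → α → β}
    (hg : ∀ i x y, g i x = g i y → g (i + 1) x = g (i + 1) y) {S : ℕ → Finset β}
    (hS : ∀ i x, g i x ∈ S i) (X Y : Fin n → α) :
    ∃ σ : Equiv.Perm (Fin n), ∀ i ≤ J,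
      ((Finset.univ.filter fun k => g i (X k) ≠ g i (Y (σ k))).card : ℤ) ≤
        ∑ C ∈ S i, |(occurrences (g i ∘ X) C : ℤ) - occurrences (g i ∘ Y) C| := by
  have hmono : ∀ {i j x y}, i ≤ j → g i x = g i y → g j x = g j y := by
    intro i j x y hij
    induction hij with
    | refl => exact id
    | step _ ih => exact fun h => hg _ _ _ (ih h)
  let e : Equiv.Perm (Fin n) → ℕ → Fin n → ℕ :=
    fun σ i k => if g i (X k) = g i (Y (σ k)) then 1 else 0
  -- Extremal choice: `σ` maximises the number of agreements summed over all levels. Excess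
  -- mismatches at level `i` yield a swap that strictly increases it.
  obtain ⟨σ, hσ⟩ := Finite.exists_max fun σ : Equiv.Perm (Fin n) =>
    ∑ i ∈ Finset.range (J + 1), ∑ k, e σ i k
  refine ⟨σ, fun i hi => ?_⟩
  by_contra! hlt
  simp_rw [← occurrences_comp_perm (g i ∘ Y) σ] at hlt
  obtain ⟨k, l, hkl, hk, hl⟩ := exists_mismatch_pair (fun k => hS i (X k)) hlt
  simp only [Function.comp_apply] at hkl hk hl
  have hne : k ≠ l := by rintro rfl; exact hk hkl
  set τ : Equiv.Perm (Fin n) := (Equiv.swap k l).trans σ with hτ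
  have τk : τ k = σ l := by simp [hτ]
  have τl : τ l = σ k := by simp [hτ]
  have hsum : ∀ j, ∑ m, e σ j m + (e τ j k + e τ j l) = ∑ m, e τ j m + (e σ j k + e σ j l) := by
    intro j
    refine sum_add_eq_sum_add_of_eq_off_pair hne fun m hm hm' => ?_
    simp [e, hτ, Equiv.swap_apply_of_ne_of_ne hm hm']
  -- Levels finer than `i` lose nothing, since pairs that mismatch at level `i` mismatch at all
  -- finer levels.
  have hfine : ∀ j ≤ i, e σ j k = 0 ∧ e σ j l = 0 := fun j hj =>
    ⟨if_neg fun h => hk (hmono hj h), if_neg fun h => hl (hmono hj h)⟩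
  have hcoarse : ∀ j, i ≤ j → e τ j k = 1 := fun j hj => by
    simp only [e, τk]; exact if_pos (hmono hj hkl)
  refine (hσ τ).not_gt (Finset.sum_lt_sum (fun j _ => ?_) ⟨i, by simpa [Nat.lt_succ_iff] using hi, ?_⟩)
  · have := hsum j
    rcases le_total j i with hj | hj
    · have := hfine j hj
      omega
    · have h1 := hcoarse j hj
      have hkl' := hmono hj hkl
      -- At coarser levels `k` agrees after the swap; if both pairs agreed before, transitivity
      -- makes `l` agree as well.
      have : e σ j k + e σ j l ≤ 1 + e τ j l := by
        simp only [e, τl]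
        split_ifs with h2 h3 h4 <;> simp_all
      omega
  · have := hsum i
    have := hfine i le_rfl
    have := hcoarse i le_rfl
    omega

end Matching

/-! ### Wasserstein distance bounded by a matching. -/

section WassersteinUpper

variable {T : Type*} [MetricSpace T] [CompactSpace T] [MeasurableSpace T] [BorelSpace T]

/-- Any matching of two data sets of the same size bounds the Wasserstein distance. -/
lemma wasserstein_empiricalMeasure_le {n : ℕ} (X Y : Fin n → T) (σ : Equiv.Perm (Fin n)) :
    wasserstein (empiricalMeasure Y) (empiricalMeasure X) ≤
      (n : ℝ≥0∞)⁻¹ * ∑ k, edist (X k) (Y (σ k)) := by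
  let γ : Measure (T × T) := (n : ℝ≥0∞)⁻¹ • ∑ k, Measure.dirac (Y (σ k), X k)
  have hγ : IsCoupling γ (empiricalMeasure Y) (empiricalMeasure X) := by
    constructor
    · ext s hs
      rw [Measure.map_apply measurable_fst hs]
      simp only [γ, empiricalMeasure, Measure.smul_apply, Measure.finsetSum_apply,
        Measure.dirac_apply' _ (measurable_fst hs), Measure.dirac_apply' _ hs]
      congr 1
      exact Equiv.sum_comp σ fun k => s.indicator (1 : T → ℝ≥0∞) (Y k)
    · ext s hs
      rw [Measure.map_apply measurable_snd hs]
      simp only [γ, empiricalMeasure, Measure.smul_apply, Measure.finsetSum_apply,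
        Measure.dirac_apply' _ (measurable_snd hs), Measure.dirac_apply' _ hs]
      rfl
  refine (iInf₂_le γ hγ).trans_eq ?_
  simp only [γ, lintegral_smul_measure, lintegral_finsetSum_measure, smul_eq_mul]
  congr 1
  refine Finset.sum_congr rfl fun k _ => ?_
  rw [lintegral_dirac' _ (by fun_prop), edist_comm]

end WassersteinUpper

/-! ### Trees of nets and the histogram bound. -/

section Tree

variable {T : Type*}

/-- Iterated rounding: `c i` rounds to the net of level `i`, where level `0` is the finest. -/
def roundTo (c : ℕ → T → T) : ℕ → T → T
  | 0 => c 0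
  | i + 1 => c (i + 1) ∘ roundTo c i

lemma roundTo_succ_eq (c : ℕ → T → T) (i : ℕ) (x y : T) (h : roundTo c i x = roundTo c i y) :
    roundTo c (i + 1) x = roundTo c (i + 1) y := by
  simp [roundTo, h]

lemma roundTo_mem {c : ℕ → T → T} {S : ℕ → Finset T} (hS : ∀ i x, c i x ∈ S i) (i : ℕ) (x : T) :
    roundTo c i x ∈ S i := by
  cases i <;> exact hS _ _

variable [MetricSpace T]

-- Climb from `x` and `y` until their ancestors coincide: each level where they differ costs two
-- rounding errors, at most `r i`, and at level `J` the bound on all distances ends the chain. The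
-- term `2 * s 0` pays for the initial rounding.
open Classical in
lemma dist_le_sum_roundTo {c : ℕ → T → T} {s : ℕ → ℝ} (hc : ∀ i x, dist (c i x) x ≤ s i)
    {r : ℕ → ℝ} (hr : ∀ i, 2 * s (i + 1) ≤ r i) {J : ℕ} (hJ : ∀ x y : T, dist x y ≤ r J) (x y : T) :
    dist x y ≤ 2 * s 0 +
      ∑ i ∈ Finset.range (J + 1), if roundTo c i x ≠ roundTo c i y then r i else 0 := by
  have hstep : ∀ i, dist (roundTo c i x) (roundTo c i y) ≤
      (if roundTo c i x ≠ roundTo c i y then r i else 0) +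
        dist (roundTo c (i + 1) x) (roundTo c (i + 1) y) := by
    intro i
    split_ifs with h
    · have h1 := hc (i + 1) (roundTo c i x)
      have h2 := hc (i + 1) (roundTo c i y)
      have h3 := dist_triangle4 (roundTo c i x) (roundTo c (i + 1) x) (roundTo c (i + 1) y)
        (roundTo c i y)
      have h4 := hr i
      rw [dist_comm] at h1
      simp only [roundTo, Function.comp_apply] at h3 ⊢
      linarith
    · push Not at h
      rw [h]; simp
  have hmain : ∀ m, dist (roundTo c 0 x) (roundTo c 0 y) ≤
      (∑ i ∈ Finset.range m, if roundTo c i x ≠ roundTo c i y then r i else 0) +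
        dist (roundTo c m x) (roundTo c m y) := by
    intro m
    induction m with
    | zero => simp
    | succ m ih => rw [Finset.sum_range_succ]; linarith [hstep m]
  have htop : dist (roundTo c J x) (roundTo c J y) ≤
      if roundTo c J x ≠ roundTo c J y then r J else 0 := by
    split_ifs with h
    · exact hJ _ _
    · push Not at h; simp [h]
  have h1 := hc 0 x
  have h2 := hc 0 y
  have h3 := dist_triangle4 x (roundTo c 0 x) (roundTo c 0 y) y
  rw [dist_comm] at h1
  rw [Finset.sum_range_succ]
  have := hmain J
  simp only [roundTo] at *
  linarith

variable [CompactSpace T] [MeasurableSpace T] [BorelSpace T]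

/-- The Wasserstein distance of two data sets is controlled by their histograms in a tree. -/
theorem wasserstein_le_sum_occurrences {c : ℕ → T → T} {s : ℕ → ℝ}
    (hc : ∀ i x, dist (c i x) x ≤ s i) {S : ℕ → Finset T} (hS : ∀ i x, c i x ∈ S i)
    {r : ℕ → ℝ} (hr0 : ∀ i, 0 ≤ r i) (hr : ∀ i, 2 * s (i + 1) ≤ r i) {J : ℕ}
    (hJ : ∀ x y : T, dist x y ≤ r J) {n : ℕ} (hn : n ≠ 0) (X Y : Fin n → T) :
    wasserstein (empiricalMeasure Y) (empiricalMeasure X) ≤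
      ENNReal.ofReal (2 * s 0 + (n : ℝ)⁻¹ * ∑ i ∈ Finset.range (J + 1), r i *
        ∑ C ∈ S i, |(occurrences (roundTo c i ∘ X) C : ℝ) - occurrences (roundTo c i ∘ Y) C|) := by
  classical
  obtain ⟨σ, hσ⟩ := exists_perm_card_mismatch_le (J := J) (roundTo_succ_eq c) (roundTo_mem hS) X Y
  refine (wasserstein_empiricalMeasure_le X Y σ).trans ?_
  have hn' : (0 : ℝ) < n := by positivity
  simp_rw [edist_dist]
  rw [← ENNReal.ofReal_sum_of_nonneg (fun _ _ => dist_nonneg), ← ENNReal.ofReal_natCast,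
    ← ENNReal.ofReal_inv_of_pos hn', ← ENNReal.ofReal_mul (by positivity)]
  refine ENNReal.ofReal_le_ofReal ?_
  calc (n : ℝ)⁻¹ * ∑ k, dist (X k) (Y (σ k))
      ≤ (n : ℝ)⁻¹ * ∑ k, (2 * s 0 + ∑ i ∈ Finset.range (J + 1),
          if roundTo c i (X k) ≠ roundTo c i (Y (σ k)) then r i else 0) := by
        gcongr with k
        exact dist_le_sum_roundTo hc hr hJ _ _
    _ = 2 * s 0 + (n : ℝ)⁻¹ * ∑ i ∈ Finset.range (J + 1), r i *
          ((Finset.univ.filter fun k => roundTo c i (X k) ≠ roundTo c i (Y (σ k))).card : ℝ) := by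
        rw [Finset.sum_add_distrib, mul_add, Finset.sum_comm]
        congr 1
        · simp; field_simp
        · congr 1
          refine Finset.sum_congr rfl fun i _ => ?_
          rw [← Finset.sum_filter, Finset.sum_const, nsmul_eq_mul, mul_comm]
    _ ≤ _ := by
        gcongr with i hi
        · exact hr0 i
        · exact_mod_cast hσ i (by simpa [Nat.lt_succ_iff] using hi)

end Tree

/-! ### Algorithms with finitely many outputs. -/

section FiniteMechanism

/-- With measurable singletons, integrals against Dirac masses can be evaluated without knowing that
the Wasserstein error is measurable in `Y`. -/
instance {T : Type*} [MeasurableSpace T] [MeasurableSingletonClass T] :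
    MeasurableSingletonClass (SyntheticData T) := by
  refine ⟨fun Y => MeasurableSpace.measurableSet_iInf.2 fun m => ?_⟩
  change MeasurableSet ((fun y : Fin (m : ℕ) → T => (⟨m, y⟩ : SyntheticData T)) ⁻¹' {Y})
  refine Set.Subsingleton.measurableSet fun y hy y' hy' => ?_
  have h : (⟨m, y⟩ : SyntheticData T) = ⟨m, y'⟩ := Eq.trans hy (Eq.symm hy')
  simpa using h

open Classical in
/-- An algorithm with finitely many outputs is given by its table of probabilities. -/
theorem exists_algorithm_of_table {T : Type*} [MetricSpace T] [MeasurableSpace T] [BorelSpace T]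
    {n : ℕ} {Ω : Type*} [Fintype Ω] {ε : ℝ} (p : (Fin n → T) → Ω → ℝ) (hp : ∀ X ω, 0 ≤ p X ω)
    (hsum : ∀ X, ∑ ω, p X ω = 1)
    (hdp : ∀ X X', hammingDist X X' ≤ 1 → ∀ ω, p X ω ≤ Real.exp ε * p X' ω)
    (out : Ω → SyntheticData T) :
    ∃ A : RandomizedAlgorithm T n (SyntheticData T), IsDifferentiallyPrivate ε A ∧
      ∀ X, expectedError A X = ∑ ω, ENNReal.ofReal (p X ω) *
        wasserstein (empiricalMeasure (out ω).2) (empiricalMeasure X) := by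
  let μ : (Fin n → T) → Measure (SyntheticData T) := fun X =>
    ∑ ω, ENNReal.ofReal (p X ω) • Measure.dirac (out ω)
  have hμ : ∀ X, IsProbabilityMeasure (μ X) := fun X => ⟨by
    simp only [μ, Measure.finsetSum_apply, Measure.smul_apply, measure_univ, smul_eq_mul, mul_one]
    rw [← ENNReal.ofReal_sum_of_nonneg fun ω _ => hp X ω, hsum, ENNReal.ofReal_one]⟩
  refine ⟨fun X => ⟨μ X, hμ X⟩, ?_, fun X => ?_⟩
  · intro X X' h S _
    simp only [ProbabilityMeasure.coe_mk, μ, Measure.finsetSum_apply, Measure.smul_apply, smul_eq_mul]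
    rw [Finset.mul_sum]
    refine Finset.sum_le_sum fun ω _ => ?_
    rw [← mul_assoc, ← ENNReal.ofReal_mul (Real.exp_nonneg _)]
    gcongr
    exact hdp X X' (by convert h) ω
  · simp only [expectedError, ProbabilityMeasure.coe_mk, μ, lintegral_finsetSum_measure,
      lintegral_smul_measure, lintegral_dirac, smul_eq_mul]

end FiniteMechanism

/-! ### Truncated two-sided geometric noise. -/

section Noise

/-- The normalising constant of the truncated two-sided geometric distribution. -/
def noiseTotal (n : ℕ) (a : ℝ) (x : Fin (n + 1)) : ℝ :=
  ∑ y : Fin (n + 1), Real.exp (-(a * |(y : ℝ) - x|))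

/-- The truncated two-sided geometric distribution on `{0, …, n}` centred at `x`. -/
def noiseWeight (n : ℕ) (a : ℝ) (x y : Fin (n + 1)) : ℝ :=
  Real.exp (-(a * |(y : ℝ) - x|)) / noiseTotal n a x

variable {n : ℕ} {a : ℝ}

lemma one_le_noiseTotal (x : Fin (n + 1)) : 1 ≤ noiseTotal n a x := by
  have := Finset.single_le_sum (f := fun y : Fin (n + 1) => Real.exp (-(a * |(y : ℝ) - x|)))
    (fun y _ => (Real.exp_pos _).le) (Finset.mem_univ x)
  simpa [noiseTotal] using this

lemma noiseTotal_pos (x : Fin (n + 1)) : 0 < noiseTotal n a x :=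
  zero_lt_one.trans_le (one_le_noiseTotal x)

lemma noiseWeight_nonneg (x y : Fin (n + 1)) : 0 ≤ noiseWeight n a x y :=
  div_nonneg (Real.exp_pos _).le (noiseTotal_pos x).le

lemma sum_noiseWeight (x : Fin (n + 1)) : ∑ y, noiseWeight n a x y = 1 := by
  simp only [noiseWeight, ← Finset.sum_div]
  exact div_self (noiseTotal_pos x).ne'

lemma exp_neg_mul_abs_le (ha : 0 ≤ a) (x x' y : ℝ) :
    Real.exp (-(a * |y - x|)) ≤ Real.exp (a * |x - x'|) * Real.exp (-(a * |y - x'|)) := by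
  rw [← Real.exp_add]
  refine Real.exp_le_exp.2 ?_
  nlinarith [abs_sub_le y x x']

/-- The factor `2` in the exponent: truncation makes the normalising constant depend on the centre,
and it costs as much as the numerator. -/
lemma noiseWeight_le (ha : 0 ≤ a) (x x' y : Fin (n + 1)) :
    noiseWeight n a x y ≤ Real.exp (2 * a * |(x : ℝ) - x'|) * noiseWeight n a x' y := by
  have h2 : noiseTotal n a x' ≤ Real.exp (a * |(x : ℝ) - x'|) * noiseTotal n a x := by
    rw [noiseTotal, noiseTotal, Finset.mul_sum]
    refine Finset.sum_le_sum fun y _ => ?_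
    rw [abs_sub_comm (x : ℝ)]
    exact exp_neg_mul_abs_le ha _ _ _
  rw [noiseWeight, noiseWeight, ← mul_div_assoc, div_le_div_iff₀ (noiseTotal_pos _) (noiseTotal_pos _)]
  calc _ ≤ (Real.exp (a * |(x : ℝ) - x'|) * Real.exp (-(a * |(y : ℝ) - x'|))) *
        (Real.exp (a * |(x : ℝ) - x'|) * noiseTotal n a x) := by
          gcongr
          · exact (noiseTotal_pos _).le
          · exact exp_neg_mul_abs_le ha _ _ _
    _ = _ := by
      rw [show 2 * a * |(x : ℝ) - x'| = a * |(x : ℝ) - x'| + a * |(x : ℝ) - x'| by ring, Real.exp_add]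
      ring

/-- At most two integers lie at a given distance from `x`. -/
lemma sum_abs_sub_le (f : ℕ → ℝ) (hf : ∀ k, 0 ≤ f k) (x : Fin (n + 1)) :
    ∑ y : Fin (n + 1), f ((y : ℤ) - x).natAbs ≤ 2 * ∑ k ∈ Finset.range (n + 1), f k := by
  rw [← Finset.sum_fiberwise_of_maps_to (s := Finset.univ) (t := Finset.range (n + 1))
    (g := fun y : Fin (n + 1) => ((y : ℤ) - x).natAbs), Finset.mul_sum]
  · refine Finset.sum_le_sum fun k _ => ?_
    rw [Finset.sum_congr rfl (g := fun _ => f k) (fun y hy => by rw [(Finset.mem_filter.1 hy).2]),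
      Finset.sum_const, nsmul_eq_mul]
    refine mul_le_mul_of_nonneg_right ?_ (hf k)
    have : (Finset.univ.filter fun y : Fin (n + 1) => ((y : ℤ) - x).natAbs = k).card ≤
        ({(x : ℤ) - k, (x : ℤ) + k} : Finset ℤ).card := by
      refine Finset.card_le_card_of_injOn (fun y => (y : ℤ)) ?_ ?_
      · intro y hy
        have := (Finset.mem_filter.1 hy).2
        simp only [Finset.coe_insert, Finset.coe_singleton, Set.mem_insert_iff,
          Set.mem_singleton_iff]
        omega
      · intro y _ z _ h
        have : (y : ℤ) = z := h
        exact Fin.ext (by exact_mod_cast this)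
    exact_mod_cast this.trans Finset.card_le_two
  · intro y _
    have := y.2; have := x.2
    simp only [Finset.mem_range]
    omega

lemma sum_mul_exp_le (ha : 0 < a) (ha1 : a ≤ 1) (m : ℕ) :
    ∑ k ∈ Finset.range m, (k : ℝ) * Real.exp (-(a * k)) ≤ 3 / a ^ 2 := by
  set q := Real.exp (-a) with hq
  have hq0 : 0 < q := Real.exp_pos _
  have hq1 : q < 1 := by rw [hq, Real.exp_lt_one_iff]; linarith
  have hs := hasSum_coe_mul_geometric_of_norm_lt_one (r := q) (by
    rwa [Real.norm_of_nonneg hq0.le])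
  have h1 : ∑ k ∈ Finset.range m, (k : ℝ) * Real.exp (-(a * k)) ≤ q / (1 - q) ^ 2 := by
    refine le_trans (le_of_eq ?_) (sum_le_hasSum (Finset.range m) (fun k _ => by positivity) hs)
    refine Finset.sum_congr rfl fun k _ => ?_
    rw [hq, ← Real.exp_nat_mul]; congr 2; ring
  -- From `1 + a ≤ exp a` and, as `a ≤ 1`, `exp a ≤ 3`: the series `q / (1 - q) ^ 2` is at most `1 /
  -- (a ^ 2 * q) ≤ 3 / a ^ 2`.
  have h2 : a * q ≤ 1 - q := by
    have h := Real.add_one_le_exp a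
    have h3 : Real.exp a * q = 1 := by rw [hq, ← Real.exp_add]; simp
    nlinarith
  have h3 : 1 ≤ 3 * q := by
    have h4 : Real.exp a * q = 1 := by rw [hq, ← Real.exp_add]; simp
    have h5 : Real.exp a ≤ 3 := (Real.exp_le_exp.2 ha1).trans Real.exp_one_lt_three.le
    nlinarith
  refine h1.trans ?_
  have haq : 0 < a * q := by positivity
  rw [div_le_div_iff₀ (by nlinarith) (by positivity)]
  nlinarith [mul_self_le_mul_self haq.le h2, mul_le_mul_of_nonneg_right h3 hq0.le, sq_nonneg (1 - q)]

lemma sum_noiseWeight_mul_abs_le (ha : 0 < a) (ha1 : a ≤ 1) (x : Fin (n + 1)) :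
    ∑ y, noiseWeight n a x y * |(y : ℝ) - x| ≤ 6 / a ^ 2 := by
  calc ∑ y, noiseWeight n a x y * |(y : ℝ) - x|
      ≤ ∑ y : Fin (n + 1), (fun k : ℕ => (k : ℝ) * Real.exp (-(a * k))) ((y : ℤ) - x).natAbs := by
        refine Finset.sum_le_sum fun y _ => ?_
        have hk : ((((y : ℤ) - x).natAbs : ℕ) : ℝ) = |(y : ℝ) - x| := by
          rw [Nat.cast_natAbs]; push_cast; rfl
        simp only [hk]
        rw [mul_comm]
        gcongr
        exact div_le_self (Real.exp_pos _).le (one_le_noiseTotal x)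
    _ ≤ 2 * ∑ k ∈ Finset.range (n + 1), (k : ℝ) * Real.exp (-(a * k)) :=
        sum_abs_sub_le (fun k : ℕ => (k : ℝ) * Real.exp (-(a * k))) (fun k => by positivity) x
    _ ≤ 2 * (3 / a ^ 2) := by gcongr; exact sum_mul_exp_le ha ha1 _
    _ = 6 / a ^ 2 := by ring

variable {ν : Type*} [Fintype ν]

/-- Independent noise at each coordinate. -/
def noiseProduct (n : ℕ) (a : ℝ) (x y : ν → Fin (n + 1)) : ℝ := ∏ c, noiseWeight n a (x c) (y c)

lemma noiseProduct_nonneg (x y : ν → Fin (n + 1)) : 0 ≤ noiseProduct n a x y :=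
  Finset.prod_nonneg fun _ _ => noiseWeight_nonneg _ _

lemma noiseProduct_le (ha : 0 ≤ a) (x x' y : ν → Fin (n + 1)) :
    noiseProduct n a x y ≤
      Real.exp (2 * a * ∑ c, |(x c : ℝ) - x' c|) * noiseProduct n a x' y := by
  rw [Finset.mul_sum, Real.exp_sum, noiseProduct, noiseProduct, ← Finset.prod_mul_distrib]
  exact Finset.prod_le_prod (fun _ _ => noiseWeight_nonneg _ _) fun _ _ => noiseWeight_le ha _ _ _

variable [DecidableEq ν]

lemma sum_noiseProduct (x : ν → Fin (n + 1)) : ∑ y, noiseProduct n a x y = 1 := by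
  simp only [noiseProduct]
  rw [← Fintype.piFinset_univ, ← Finset.prod_univ_sum]
  simp [sum_noiseWeight]

/-- Independence: the other coordinates sum to `1`, leaving the marginal at `c`. -/
lemma sum_noiseProduct_mul (x : ν → Fin (n + 1)) (c : ν) (h : Fin (n + 1) → ℝ) :
    ∑ y, noiseProduct n a x y * h (y c) = ∑ k, noiseWeight n a (x c) k * h k := by
  have h1 : ∀ y : ν → Fin (n + 1), noiseProduct n a x y * h (y c) =
      ∏ c', noiseWeight n a (x c') (y c') * if c' = c then h (y c') else 1 := by
    intro y
    rw [Finset.prod_mul_distrib, Finset.prod_ite_eq' Finset.univ c fun c' => h (y c')]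
    simp [noiseProduct]
  simp_rw [h1]
  rw [← Fintype.piFinset_univ, ← Finset.prod_univ_sum
    (f := fun c' k => noiseWeight n a (x c') k * if c' = c then h k else 1),
    Finset.prod_eq_single c]
  · simp
  · intro c' _ hc'
    simp [hc', sum_noiseWeight]
  · simp

end Noise

/-! ### The private algorithm: noisy counts, then the nearest data set. -/

section Synthesis

variable {T : Type*} [MetricSpace T] [MeasurableSpace T] [BorelSpace T]

open Classical in
/-- Noisy counts, followed by the choice of a data set with the closest counts. -/
theorem exists_algorithm_of_counts [Nonempty T] {n : ℕ} (hn : n ≠ 0) {ν : Type*} [Fintype ν]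
    {a D b : ℝ} (ha : 0 < a) (ha1 : a ≤ 1) (cnt : (Fin n → T) → ν → Fin (n + 1))
    (hcnt : ∀ X X', hammingDist X X' ≤ 1 → ∑ c, |(cnt X c : ℝ) - cnt X' c| ≤ D)
    {w : ν → ℝ} (hw : ∀ c, 0 ≤ w c) (hb : 0 ≤ b)
    (hW : ∀ X Y : Fin n → T, wasserstein (empiricalMeasure Y) (empiricalMeasure X) ≤
      ENNReal.ofReal (b + ∑ c, w c * |(cnt X c : ℝ) - cnt Y c|)) :
    ∃ A : RandomizedAlgorithm T n (SyntheticData T), IsDifferentiallyPrivate (2 * a * D) A ∧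
      ∀ X, expectedError A X ≤ ENNReal.ofReal (b + 12 / a ^ 2 * ∑ c, w c) := by
  -- There may be infinitely many data sets, but their counts take finitely many values, so a
  -- minimiser exists.
  have hmin : ∀ y : ν → Fin (n + 1), ∃ Y : Fin n → T, ∀ X : Fin n → T,
      ∑ c, w c * |(y c : ℝ) - cnt Y c| ≤ ∑ c, w c * |(y c : ℝ) - cnt X c| := by
    intro y
    obtain ⟨_, ⟨Y, rfl⟩, hY⟩ := Set.exists_min_image (Set.range cnt)
      (fun v => ∑ c, w c * |(y c : ℝ) - v c|) (Set.toFinite _) (Set.range_nonempty _)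
    exact ⟨Y, fun X => hY _ ⟨X, rfl⟩⟩
  choose best hbest using hmin
  obtain ⟨A, hA, herr⟩ := exists_algorithm_of_table (ε := 2 * a * D)
    (fun X => noiseProduct n a (cnt X)) (fun X y => noiseProduct_nonneg _ _)
    (fun X => sum_noiseProduct _) (fun X X' h y => (noiseProduct_le ha.le _ (cnt X') y).trans (by
      gcongr
      · exact noiseProduct_nonneg _ _
      · exact hcnt X X' (by convert h)))
    (fun y => ⟨⟨n, Nat.pos_of_ne_zero hn⟩, best y⟩)
  refine ⟨A, hA, fun X => ?_⟩
  have hbound : ∀ y, wasserstein (empiricalMeasure (best y)) (empiricalMeasure X) ≤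
      ENNReal.ofReal (b + 2 * ∑ c, w c * |(y c : ℝ) - cnt X c|) := by
    intro y
    refine (hW X (best y)).trans (ENNReal.ofReal_le_ofReal ?_)
    -- The true data compete in the minimisation, so the output is no farther from the noisy counts
    -- than they are; hence twice the noise.
    have : ∑ c, w c * |(cnt X c : ℝ) - cnt (best y) c| ≤
        ∑ c, w c * |(y c : ℝ) - cnt X c| + ∑ c, w c * |(y c : ℝ) - cnt (best y) c| := by
      rw [← Finset.sum_add_distrib]
      refine Finset.sum_le_sum fun c _ => ?_
      rw [← mul_add, abs_sub_comm (y c : ℝ) (cnt X c)]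
      exact mul_le_mul_of_nonneg_left (abs_sub_le _ _ _) (hw c)
    linarith [hbest y X]
  rw [herr]
  calc ∑ y, ENNReal.ofReal (noiseProduct n a (cnt X) y) *
        wasserstein (empiricalMeasure (best y)) (empiricalMeasure X)
      ≤ ∑ y, ENNReal.ofReal (noiseProduct n a (cnt X) y *
          (b + 2 * ∑ c, w c * |(y c : ℝ) - cnt X c|)) := by
        refine Finset.sum_le_sum fun y _ => ?_
        rw [ENNReal.ofReal_mul (noiseProduct_nonneg _ _)]
        gcongr
        exact hbound y
    _ = ENNReal.ofReal (∑ y, noiseProduct n a (cnt X) y *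
          (b + 2 * ∑ c, w c * |(y c : ℝ) - cnt X c|)) := by
        rw [ENNReal.ofReal_sum_of_nonneg]
        intro y _
        have : 0 ≤ ∑ c, w c * |(y c : ℝ) - cnt X c| :=
          Finset.sum_nonneg fun c _ => mul_nonneg (hw c) (abs_nonneg _)
        exact mul_nonneg (noiseProduct_nonneg _ _) (by positivity)
    _ ≤ _ := by
        refine ENNReal.ofReal_le_ofReal ?_
        have e1 : ∑ y, noiseProduct n a (cnt X) y * (b + 2 * ∑ c, w c * |(y c : ℝ) - cnt X c|) =
            b + 2 * ∑ c, w c * ∑ y, noiseProduct n a (cnt X) y * |(y c : ℝ) - cnt X c| := by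
          simp_rw [mul_add, Finset.sum_add_distrib, ← Finset.sum_mul, sum_noiseProduct, one_mul,
            Finset.mul_sum]
          rw [Finset.sum_comm]
          congr 1
          refine Finset.sum_congr rfl fun c _ => Finset.sum_congr rfl fun y _ => ?_
          ring
        have e2 : ∀ c, ∑ y, noiseProduct n a (cnt X) y * |(y c : ℝ) - cnt X c| ≤ 6 / a ^ 2 :=
          fun c => by
            rw [sum_noiseProduct_mul (cnt X) c fun k => |(k : ℝ) - cnt X c|]
            exact sum_noiseWeight_mul_abs_le ha ha1 _
        rw [e1]
        have e3 : ∑ c, w c * ∑ y, noiseProduct n a (cnt X) y * |(y c : ℝ) - cnt X c| ≤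
            ∑ c, w c * (6 / a ^ 2) :=
          Finset.sum_le_sum fun c _ => mul_le_mul_of_nonneg_left (e2 c) (hw c)
        rw [← Finset.sum_mul] at e3
        have e4 : 12 / a ^ 2 * ∑ c, w c = 2 * ((∑ c, w c) * (6 / a ^ 2)) := by ring
        linarith

-- A changed entry leaves one cell and enters another; all other indicators are unchanged.
open Classical in
lemma sum_abs_occurrences_sub_le {n : ℕ} {β : Type*} (S : Finset β) (u v : Fin n → β)
    (h : hammingDist u v ≤ 1) :
    ∑ C ∈ S, |(occurrences u C : ℝ) - occurrences v C| ≤ 2 := by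
  have hocc : ∀ (u : Fin n → β) C, (occurrences u C : ℝ) = ∑ k, if u k = C then 1 else 0 := by
    intro u C; simp [occurrences]
  calc ∑ C ∈ S, |(occurrences u C : ℝ) - occurrences v C|
      ≤ ∑ C ∈ S, ∑ k, |(if u k = C then 1 else 0) - (if v k = C then (1 : ℝ) else 0)| := by
        refine Finset.sum_le_sum fun C _ => ?_
        rw [hocc, hocc, ← Finset.sum_sub_distrib]
        exact Finset.abs_sum_le_sum_abs _ _
    _ = ∑ k, ∑ C ∈ S, |(if u k = C then 1 else 0) - (if v k = C then (1 : ℝ) else 0)| :=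
        Finset.sum_comm
    _ ≤ ∑ k, if u k ≠ v k then 2 else 0 := by
        refine Finset.sum_le_sum fun k _ => ?_
        split_ifs with hk
        · calc _ ≤ ∑ C ∈ S, ((if u k = C then 1 else 0) + (if v k = C then (1 : ℝ) else 0)) := by
                refine Finset.sum_le_sum fun C _ => ?_
                split_ifs <;> norm_num
            _ ≤ 2 := by
                rw [Finset.sum_add_distrib, Finset.sum_ite_eq, Finset.sum_ite_eq]
                split_ifs <;> norm_num
        · push Not at hk
          simp [hk]
    _ = 2 * (hammingDist u v : ℝ) := by
        rw [← Finset.sum_filter, Finset.sum_const, nsmul_eq_mul, hammingDist, mul_comm]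
    _ ≤ 2 := by
        have : (hammingDist u v : ℝ) ≤ 1 := by exact_mod_cast h
        linarith

lemma occurrences_lt {n : ℕ} {β : Type*} (u : Fin n → β) (C : β) : occurrences u C < n + 1 := by
  classical
  exact Nat.lt_succ_of_le ((Finset.card_filter_le _ _).trans (by simp))

/-- The private algorithm obtained from a sequence of nets. -/
theorem exists_algorithm_of_nets [CompactSpace T] [Nonempty T] {n : ℕ} (hn : n ≠ 0) {ε : ℝ}
    (hε : 0 < ε) (hε1 : ε ≤ 1) {c : ℕ → T → T} {s : ℕ → ℝ} (hs : 0 ≤ s 0)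
    (hc : ∀ i x, dist (c i x) x ≤ s i) {S : ℕ → Finset T} (hS : ∀ i x, c i x ∈ S i)
    {r : ℕ → ℝ} (hr0 : ∀ i, 0 ≤ r i) (hr : ∀ i, 2 * s (i + 1) ≤ r i) {J : ℕ}
    (hJ : ∀ x y : T, dist x y ≤ r J) :
    ∃ A : RandomizedAlgorithm T n (SyntheticData T), IsDifferentiallyPrivate ε A ∧
      ∀ X, expectedError A X ≤ ENNReal.ofReal (2 * s 0 + 192 * (J + 1) ^ 2 / (ε ^ 2 * n) *
        ∑ i ∈ Finset.range (J + 1), r i * (S i).card) := by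
  classical
  have hJ0 : (0 : ℝ) < J + 1 := by positivity
  have hn0 : (0 : ℝ) < n := by positivity
  -- One changed entry moves each of the `J + 1` histograms by at most `2`, so `D = 2 * (J + 1)` and
  -- `2 * a * D = ε`. Then `12 / a ^ 2` produces the constant `192`.
  set a : ℝ := ε / (4 * (J + 1)) with ha
  have hsig : ∀ f : ℕ → T → ℝ, ∑ p : ↥((Finset.range (J + 1)).sigma S), f p.1.1 p.1.2 =
      ∑ i ∈ Finset.range (J + 1), ∑ C ∈ S i, f i C := by
    intro f
    rw [Finset.sum_coe_sort ((Finset.range (J + 1)).sigma S)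
      (fun p : (_ : ℕ) × T => f p.1 p.2), Finset.sum_sigma]
  obtain ⟨A, hA, herr⟩ := exists_algorithm_of_counts (T := T) hn (a := a) (D := 2 * (J + 1))
    (b := 2 * s 0) (by positivity) (by rw [ha, div_le_one (by positivity)]; nlinarith)
    (fun X (p : ↥((Finset.range (J + 1)).sigma S)) =>
      ⟨occurrences (roundTo c p.1.1 ∘ X) p.1.2, occurrences_lt _ _⟩)
    (fun X X' h => by
      simp only
      rw [hsig fun i C => |(occurrences (roundTo c i ∘ X) C : ℝ) - occurrences (roundTo c i ∘ X') C|]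
      calc _ ≤ ∑ i ∈ Finset.range (J + 1), (2 : ℝ) := by
            refine Finset.sum_le_sum fun i _ => sum_abs_occurrences_sub_le _ _ _ ?_
            exact (hammingDist_comp_le_hammingDist (fun _ => roundTo c i)).trans (by convert h)
        _ = 2 * (J + 1) := by simp; ring)
    (w := fun p => (n : ℝ)⁻¹ * r p.1.1) (fun p => mul_nonneg (by positivity) (hr0 _)) (by positivity)
    (fun X Y => by
      refine (wasserstein_le_sum_occurrences hc hS hr0 hr hJ hn X Y).trans_eq ?_
      simp only
      rw [hsig fun i C => (n : ℝ)⁻¹ * r i *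
        |(occurrences (roundTo c i ∘ X) C : ℝ) - occurrences (roundTo c i ∘ Y) C|]
      simp only [Finset.mul_sum, mul_assoc])
  refine ⟨A, ?_, fun X => (herr X).trans_eq ?_⟩
  · convert hA using 1
    rw [ha]; field_simp; ring
  · rw [hsig fun i _ => (n : ℝ)⁻¹ * r i]
    simp only [Finset.sum_const, nsmul_eq_mul]
    congr 2
    rw [Finset.mul_sum, Finset.mul_sum]
    refine Finset.sum_congr rfl fun i _ => ?_
    rw [ha]; field_simp; ring

end Synthesis

/-! ### Covering numbers and the choice of scales. -/

section Asymptotics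

variable {T : Type*} [MetricSpace T]

/-- The covering number of `T` at scale `x`, as a natural number. -/
def coverCard (T : Type*) [MetricSpace T] (x : ℝ≥0) : ℕ :=
  (Metric.coveringNumber x (Set.univ : Set T)).toNat

lemma coverCard_bounds {d η : ℝ} (hd : HasMinkowskiDim T d) (hη : 0 < η) (hηd : η < d) :
    ∃ x₀ : ℝ≥0, 0 < x₀ ∧ ∀ x : ℝ≥0, 0 < x → x < x₀ →
      (x : ℝ) ^ (-(d - η)) ≤ coverCard T x ∧ (coverCard T x : ℝ) ≤ (x : ℝ) ^ (-(d + η)) := by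
  have h1 : ∀ᶠ x : ℝ≥0 in 𝓝[>] 0, Real.log (coverCard T x : ℝ) / Real.log (1 / (x : ℝ)) ∈
      Set.Ioo (d - η) (d + η) := hd (Ioo_mem_nhds (by linarith) (by linarith))
  obtain ⟨u, hu, hsub⟩ := (mem_nhdsGT_iff_exists_Ioo_subset).1 h1
  refine ⟨min u 1, lt_min hu zero_lt_one, fun x hx hxu => ?_⟩
  have hmem : _ ∈ Set.Ioo _ _ := hsub ⟨hx, hxu.trans_le (min_le_left _ _)⟩
  have hx0 : (0 : ℝ) < x := by exact_mod_cast hx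
  have hx1 : (x : ℝ) < 1 := by exact_mod_cast hxu.trans_le (min_le_right _ _)
  have hlog : Real.log (1 / (x : ℝ)) = -Real.log x := by rw [one_div, Real.log_inv]
  have hneg : 0 < -Real.log x := by linarith [Real.log_neg hx0 hx1]
  rw [hlog] at hmem
  -- If `coverCard` were `0`, the convention `Real.log 0 = 0` would make the quotient `0`, below `d
  -- - η`.
  have hN : (0 : ℝ) < coverCard T x := by
    rcases Nat.eq_zero_or_pos (coverCard T x) with h | h
    · rw [h] at hmem
      simp at hmem
      linarith [hmem.1]
    · exact_mod_cast h
  have h2 := (lt_div_iff₀ hneg).1 hmem.1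
  have h3 := (div_lt_iff₀ hneg).1 hmem.2
  constructor
  · rw [← Real.exp_log hN, Real.rpow_def_of_pos hx0]
    exact Real.exp_le_exp.2 (by linarith)
  · rw [← Real.exp_log hN, Real.rpow_def_of_pos hx0]
    exact Real.exp_le_exp.2 (by linarith)

lemma nonempty_of_hasMinkowskiDim {d : ℝ} (hd1 : 1 ≤ d) (hd : HasMinkowskiDim T d) : Nonempty T := by
  obtain ⟨x₀, hx₀, h⟩ := coverCard_bounds hd (η := 1 / 2) (by norm_num) (by linarith)
  by_contra hT
  rw [not_nonempty_iff] at hT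
  have h1 := (h (x₀ / 2) (half_pos hx₀) (half_lt_self hx₀)).1
  have h2 : coverCard T (x₀ / 2) = 0 := by
    simp [coverCard, Set.univ_eq_empty_iff.2 hT]
  rw [h2, Nat.cast_zero] at h1
  have h3 : (0 : ℝ) < ((x₀ / 2 : ℝ≥0) : ℝ) := by exact_mod_cast half_pos hx₀
  exact h1.not_gt (Real.rpow_pos_of_pos h3 _)

lemma coveringNumber_univ_ne_top [CompactSpace T] {x : ℝ≥0} (hx : x ≠ 0) :
    Metric.coveringNumber x (Set.univ : Set T) ≠ ⊤ := by
  obtain ⟨C, hC, hfin, hcov⟩ := Metric.exists_finite_isCover_of_isCompact (s := (Set.univ : Set T)) hx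
    isCompact_univ
  exact ((hcov.coveringNumber_le_encard hC).trans_lt hfin.encard_lt_top).ne

lemma exists_net [CompactSpace T] {x : ℝ≥0} (hx : x ≠ 0) :
    ∃ (c : T → T) (S : Finset T), (∀ y, dist (c y) y ≤ x) ∧ (∀ y, c y ∈ S) ∧
      S.card = coverCard T x := by
  obtain ⟨C, -, hfin, hcov, hcard⟩ :=
    Metric.exists_set_encard_eq_coveringNumber (coveringNumber_univ_ne_top (T := T) hx)
  have hex : ∀ y, ∃ z ∈ C, dist z y ≤ x := by
    intro y
    have := Metric.isCover_iff_subset_iUnion_closedBall.1 hcov (Set.mem_univ y)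
    simp only [Set.mem_iUnion, Metric.mem_closedBall, exists_prop] at this
    obtain ⟨z, hz, hyz⟩ := this
    exact ⟨z, hz, by rwa [dist_comm]⟩
  choose c hcC hc using hex
  refine ⟨c, hfin.toFinset, hc, fun y => hfin.mem_toFinset.2 (hcC y), ?_⟩
  rw [coverCard, ← hcard, hfin.encard_eq_coe_toFinset_card, ENat.toNat_natCast]

lemma coverCard_anti [CompactSpace T] {x y : ℝ≥0} (hx : x ≠ 0) (h : x ≤ y) :
    coverCard T y ≤ coverCard T x :=
  ENat.toNat_le_toNat (Metric.coveringNumber_anti h) (coveringNumber_univ_ne_top hx)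

/-- The dimension only controls small `x`; for larger `x` monotonicity gives a constant bound. -/
lemma exists_coverCard_le [CompactSpace T] {d η : ℝ} (hd : HasMinkowskiDim T d) (hη : 0 < η)
    (hηd : η < d) :
    ∃ C : ℝ, 0 < C ∧ ∀ x : ℝ≥0, 0 < x → x ≤ 1 → (coverCard T x : ℝ) ≤ C * (x : ℝ) ^ (-(d + η)) := by
  obtain ⟨x₀, hx₀, h⟩ := coverCard_bounds hd hη hηd
  refine ⟨1 + coverCard T (x₀ / 2), by positivity, fun x hx hx1 => ?_⟩
  have hx0 : (0 : ℝ) < x := by exact_mod_cast hx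
  rcases lt_or_ge x x₀ with hlt | hge
  · refine (h x hx hlt).2.trans (le_mul_of_one_le_left (by positivity) ?_)
    linarith [Nat.cast_nonneg (α := ℝ) (coverCard T (x₀ / 2))]
  · have h1 : (1 : ℝ) ≤ (x : ℝ) ^ (-(d + η)) :=
      Real.one_le_rpow_of_pos_of_le_one_of_nonpos hx0 (by exact_mod_cast hx1) (by linarith)
    have h2 : (coverCard T x : ℝ) ≤ coverCard T (x₀ / 2) := by
      exact_mod_cast coverCard_anti (half_pos hx₀).ne' ((half_le_self hx₀.le).trans hge)
    nlinarith [Nat.cast_nonneg (α := ℝ) (coverCard T (x₀ / 2))]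

/-- The packing number is at least the covering number. -/
lemma exists_separated {x : ℝ≥0} {n : ℕ} (h : n < coverCard T x) :
    ∃ z : Fin (n + 1) → T, Pairwise fun i j => (x : ℝ) ≤ dist (z i) (z j) := by
  have h1 : (n : ℕ∞) < Metric.packingNumber x (Set.univ : Set T) := by
    refine lt_of_lt_of_le ?_ (Metric.coveringNumber_le_packingNumber _ _)
    refine lt_of_lt_of_le ?_ (ENat.natCast_toNat_le_self _)
    exact_mod_cast h
  simp only [Metric.packingNumber, lt_iSup_iff] at h1
  obtain ⟨C, -, hC, hn⟩ := h1
  have h2 : ((n + 1 : ℕ) : ℕ∞) ≤ C.encard := by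
    push_cast; exact Order.add_one_le_of_lt hn
  obtain ⟨D, hDC, hD⟩ := Set.exists_subset_encard_eq h2
  have hfin : D.Finite := Set.finite_of_encard_eq_coe hD
  have hcard : hfin.toFinset.card = n + 1 := by
    rw [hfin.encard_eq_coe_toFinset_card] at hD
    exact_mod_cast hD
  refine ⟨fun i => (hfin.toFinset.equivFinOfCardEq hcard).symm i, fun i j hij => ?_⟩
  have hmem : ∀ i, (((hfin.toFinset.equivFinOfCardEq hcard).symm i : hfin.toFinset) : T) ∈ C :=
    fun i => hDC (hfin.mem_toFinset.1 (Subtype.coe_prop _))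
  have h3 : (x : ℝ≥0∞) < edist _ _ :=
    hC (hmem i) (hmem j) fun h => hij ((Equiv.injective _) (Subtype.ext h))
  rw [edist_nndist] at h3
  exact (NNReal.coe_lt_coe.2 (ENNReal.coe_lt_coe.1 h3)).le

lemma tendsto_natCast_rpow_atTop {p : ℝ} (hp : 0 < p) :
    Tendsto (fun n : ℕ => (n : ℝ) ^ p) atTop atTop :=
  (tendsto_rpow_atTop hp).comp tendsto_natCast_atTop_atTop

variable [CompactSpace T] [MeasurableSpace T] [BorelSpace T]

theorem eventually_le_expectedError {d : ℝ} (hd1 : 1 ≤ d) (hd : HasMinkowskiDim T d) {ε : ℝ}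
    (hε : 0 < ε) {s : ℝ} (hs : 1 / d < s) :
    ∀ᶠ n : ℕ in atTop, ∀ A : RandomizedAlgorithm T n (SyntheticData T),
      IsDifferentiallyPrivate ε A →
        ∃ X, ENNReal.ofReal ((n : ℝ) ^ (-s)) ≤ expectedError A X := by
  have hd0 : 0 < d := by linarith
  obtain ⟨t, ht, hts⟩ := exists_between hs
  have ht0 : 0 < t := (by positivity : 0 < 1 / d).trans ht
  have htd : 1 < t * d := by rwa [div_lt_iff₀ hd0] at ht
  -- With this `η` the covering number at scale `n ^ (-t)` is at least `n * n ^ ((t * d - 1) / 2) ≥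
  -- 2 * n`.
  set η : ℝ := (d - 1 / t) / 2 with hη
  have htη : t * η = (t * d - 1) / 2 := by rw [hη]; field_simp
  have hη0 : 0 < η := by
    have : 0 < t * η := by rw [htη]; linarith
    exact pos_of_mul_pos_right this ht0.le
  have hηd : η < d := by
    have : 0 < 1 / t := by positivity
    rw [hη]; linarith
  obtain ⟨x₀, hx₀, h⟩ := coverCard_bounds hd hη0 hηd
  have e1 : ∀ᶠ n : ℕ in atTop, (n : ℝ) ^ (-t) < x₀ := by
    have := (tendsto_rpow_neg_atTop ht0).comp (tendsto_natCast_atTop_atTop (R := ℝ))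
    exact this.eventually_lt_const (by exact_mod_cast hx₀)
  have e2 : ∀ᶠ n : ℕ in atTop, 2 ≤ (n : ℝ) ^ ((t * d - 1) / 2) :=
    (tendsto_natCast_rpow_atTop (by linarith)).eventually_ge_atTop 2
  -- The `8` is the `4` of `exists_le_expectedError` times the `2` from `r = x / 2`.
  have e3 : ∀ᶠ n : ℕ in atTop, 8 * Real.exp ε ≤ (n : ℝ) ^ (s - t) :=
    (tendsto_natCast_rpow_atTop (by linarith)).eventually_ge_atTop _
  filter_upwards [e1, e2, e3, eventually_ge_atTop 2] with n h1 h2 h3 hn A hA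
  have hn0 : (0 : ℝ) < n := by positivity
  have hn2 : (2 : ℝ) ≤ n := by exact_mod_cast hn
  set x : ℝ≥0 := (n : ℝ≥0) ^ (-t) with hx
  have hxr : (x : ℝ) = (n : ℝ) ^ (-t) := by simp [hx]
  have hx0 : 0 < x := by
    have : (0 : ℝ) < x := by rw [hxr]; positivity
    exact_mod_cast this
  have hcov := (h x hx0 (by rw [← NNReal.coe_lt_coe, hxr]; exact h1)).1
  rw [hxr, ← Real.rpow_mul hn0.le,
    show -t * -(d - η) = 1 + (t * d - 1) / 2 by linarith, Real.rpow_add hn0, Real.rpow_one] at hcov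
  have hlt : n < coverCard T x := by
    have : (n : ℝ) < coverCard T x := by nlinarith
    exact_mod_cast this
  obtain ⟨z, hz⟩ := exists_separated hlt
  obtain ⟨X, hX⟩ := exists_le_expectedError (by omega) hε.le hA (r := x / 2) (by positivity) (z := z)
    (fun i j hij => by simpa [mul_div_cancel₀] using hz hij)
  refine ⟨X, ?_⟩
  have hK : 4 * ENNReal.ofReal (Real.exp ε) = ENNReal.ofReal (4 * Real.exp ε) := by
    rw [ENNReal.ofReal_mul (by norm_num)]; simp
  have hKpos : 0 < 4 * Real.exp ε := by positivity
  rw [hK] at hX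
  refine (ENNReal.mul_le_mul_iff_right (a := ENNReal.ofReal (4 * Real.exp ε))
    (by simpa using hKpos) ENNReal.ofReal_ne_top).1 (le_trans ?_ hX)
  rw [← ENNReal.ofReal_mul hKpos.le, hxr]
  refine ENNReal.ofReal_le_ofReal ?_
  have h4 : (n : ℝ) ^ (-t) = (n : ℝ) ^ (s - t) * (n : ℝ) ^ (-s) := by
    rw [← Real.rpow_add hn0]; congr 1; ring
  rw [h4]
  have := mul_le_mul_of_nonneg_right h3 (Real.rpow_nonneg hn0.le (-s))
  linarith

/-- The error bound for a tree of depth `J`. -/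
theorem exists_algorithm_of_depth [Nonempty T] {d η : ℝ} (hd : HasMinkowskiDim T d) (hη : 0 < η)
    (hηd : η < d) (hd1 : 1 ≤ d) {ε : ℝ} (hε : 0 < ε) (hε1 : ε ≤ 1) :
    ∃ K : ℝ, 0 < K ∧ ∀ n : ℕ, n ≠ 0 → ∀ J : ℕ,
      ∃ A : RandomizedAlgorithm T n (SyntheticData T), IsDifferentiallyPrivate ε A ∧
        ∀ X, expectedError A X ≤ ENNReal.ofReal
          (2 / 2 ^ J + K * (J + 1) ^ 3 / n * ((2 : ℝ) ^ J) ^ (d + η - 1)) := by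
  obtain ⟨C, hC, hcov⟩ := exists_coverCard_le hd hη hηd
  -- `B ≥ 4` gives `2 * s (i + 1) ≤ r i` for doubling scales, and `B ≥ diam T` gives the bound on
  -- distances at the top level.
  set B : ℝ := max 4 (Metric.diam (Set.univ : Set T)) with hB
  have hB4 : 4 ≤ B := le_max_left _ _
  refine ⟨192 / ε ^ 2 * (B * C), by positivity, fun n hn J => ?_⟩
  have hn0 : (0 : ℝ) < n := by positivity
  have hx : ∀ i : ℕ, (2 ^ i / 2 ^ J : ℝ≥0) ≠ 0 := fun i => by positivity
  choose c S hc hS hcard using fun i => exists_net (T := T) (hx i)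
  obtain ⟨A, hA, herr⟩ := exists_algorithm_of_nets hn hε hε1 (c := c)
    (s := fun i => ((2 ^ i / 2 ^ J : ℝ≥0) : ℝ)) (NNReal.coe_nonneg _) hc hS
    (r := fun i => B * (2 ^ i / 2 ^ J)) (fun i => by positivity)
    (fun i => by
      push_cast
      have : (0 : ℝ) ≤ 2 ^ i / 2 ^ J := by positivity
      calc (2 : ℝ) * (2 ^ (i + 1) / 2 ^ J) = 4 * (2 ^ i / 2 ^ J) := by ring
        _ ≤ B * (2 ^ i / 2 ^ J) := by gcongr) (J := J)
    (fun x y => by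
      rw [div_self (by positivity), mul_one]
      exact (Metric.dist_le_diam_of_mem isCompact_univ.isBounded (Set.mem_univ _)
        (Set.mem_univ _)).trans (le_max_right _ _))
  refine ⟨A, hA, fun X => (herr X).trans (ENNReal.ofReal_le_ofReal ?_)⟩
  -- The exponent `d + η - 1` is nonnegative because `d ≥ 1`, so the finest scale dominates every
  -- level.
  have hterm : ∀ i ∈ Finset.range (J + 1), B * (2 ^ i / 2 ^ J) * ((S i).card : ℝ) ≤
      B * C * ((2 : ℝ) ^ J) ^ (d + η - 1) := by
    intro i hi
    have hiJ : i ≤ J := by simpa [Nat.lt_succ_iff] using hi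
    rw [hcard]
    set u : ℝ := 2 ^ i / 2 ^ J with hu
    have hu0 : 0 < u := by positivity
    have hu1 : u ≤ 1 := by
      rw [hu, div_le_one (by positivity)]; gcongr; norm_num
    have hxu : ((2 ^ i / 2 ^ J : ℝ≥0) : ℝ) = u := by push_cast; rfl
    have h1 := hcov (2 ^ i / 2 ^ J) (by positivity) (by rw [← NNReal.coe_le_coe, hxu]; simpa using hu1)
    rw [hxu] at h1
    have h2 : u * u ^ (-(d + η)) = (u⁻¹) ^ (d + η - 1) := by
      rw [Real.inv_rpow hu0.le, ← Real.rpow_neg hu0.le]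
      nth_rewrite 1 [← Real.rpow_one u]
      rw [← Real.rpow_add hu0]; congr 1; ring
    have h3 : u⁻¹ ≤ 2 ^ J := by
      rw [hu, inv_div]
      exact div_le_self (by positivity) (one_le_pow₀ (by norm_num))
    have h4 : (u⁻¹) ^ (d + η - 1) ≤ ((2 : ℝ) ^ J) ^ (d + η - 1) :=
      Real.rpow_le_rpow (by positivity) h3 (by linarith)
    calc B * u * (coverCard T (2 ^ i / 2 ^ J) : ℝ) ≤ B * u * (C * u ^ (-(d + η))) := by gcongr
      _ = B * C * (u * u ^ (-(d + η))) := by ring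
      _ ≤ _ := by rw [h2]; gcongr
  have hsum := Finset.sum_le_sum hterm
  rw [Finset.sum_const, Finset.card_range, nsmul_eq_mul] at hsum
  push_cast at hsum ⊢
  calc _ ≤ 2 * ((2 : ℝ) ^ 0 / 2 ^ J) + 192 * ((J : ℝ) + 1) ^ 2 / (ε ^ 2 * n) *
        (((J : ℝ) + 1) * (B * C * ((2 : ℝ) ^ J) ^ (d + η - 1))) := by gcongr
    _ = _ := by field_simp; try ring

theorem eventually_expectedError_le {d : ℝ} (hd1 : 1 ≤ d) (hd : HasMinkowskiDim T d) {ε : ℝ}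
    (hε : 0 < ε) (hε1 : ε ≤ 1) {s : ℝ} (hs : s < 1 / d) :
    ∀ᶠ n : ℕ in atTop, ∃ A : RandomizedAlgorithm T n (SyntheticData T),
      IsDifferentiallyPrivate ε A ∧
        ∀ X, expectedError A X ≤ ENNReal.ofReal ((n : ℝ) ^ (-s)) := by
  have : Nonempty T := nonempty_of_hasMinkowskiDim hd1 hd
  have hd0 : 0 < d := by linarith
  -- The `max` keeps `t` positive even if `s` is negative, so that `η = 1 - t * d < 1 ≤ d`.
  obtain ⟨t, hst, ht⟩ := exists_between (max_lt hs (by positivity : 0 < 1 / d))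
  have hst' : s < t := (le_max_left _ _).trans_lt hst
  have ht0 : 0 < t := (le_max_right _ _).trans_lt hst
  have htd : t * d < 1 := by rwa [lt_div_iff₀ hd0] at ht
  -- Chosen so that `(d + η - 1) / d = 1 - t`: with `2 ^ J ≤ n ^ (1 / d)` the noise term is at most
  -- `n ^ (-t)` up to logarithms.
  set η : ℝ := 1 - t * d with hη
  have hη0 : 0 < η := by linarith
  have hηd : η < d := by nlinarith
  obtain ⟨K, hK, hA⟩ := exists_algorithm_of_depth hd hη0 hηd hd1 hε hε1
  have e1 : ∀ᶠ n : ℕ in atTop, 4 + K * (3 * Real.log n) ^ 3 ≤ (n : ℝ) ^ (t - s) := by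
    have h1 : (fun x : ℝ => Real.log x ^ (3 : ℝ)) =o[atTop] fun x => x ^ (t - s) :=
      isLittleO_log_rpow_rpow_atTop 3 (by linarith)
    -- The factor `27` comes from cubing `3 * log x`, and `2` reserves half of `x ^ (t - s)` for the
    -- summand `4`.
    have h2 := h1.bound (c := 1 / (2 * 27 * K)) (by positivity)
    have h3 : ∀ᶠ x : ℝ in atTop, 8 ≤ x ^ (t - s) :=
      (tendsto_rpow_atTop (by linarith)).eventually_ge_atTop 8
    have h4 : ∀ᶠ x : ℝ in atTop, 4 + K * (3 * Real.log x) ^ 3 ≤ x ^ (t - s) := by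
      filter_upwards [h2, h3, eventually_ge_atTop 1] with x h2 h3 hx
      have hl := Real.log_nonneg hx
      rw [Real.norm_of_nonneg (by positivity), Real.norm_of_nonneg (by positivity),
        div_mul_eq_mul_div, one_mul, le_div_iff₀ (by positivity)] at h2
      have : Real.log x ^ (3 : ℝ) = Real.log x ^ 3 := by
        rw [← Real.rpow_natCast]; norm_num
      rw [this] at h2
      nlinarith
    exact tendsto_natCast_atTop_atTop.eventually h4
  have e2 : ∀ᶠ n : ℕ in atTop, 1 ≤ Real.log n :=
    (Real.tendsto_log_atTop.comp tendsto_natCast_atTop_atTop).eventually_ge_atTop 1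
  filter_upwards [e1, e2, eventually_ge_atTop 1] with n h1 h2 hn
  have hn0 : (0 : ℝ) < n := by positivity
  have hn1 : (1 : ℝ) ≤ n := by exact_mod_cast hn
  set y : ℝ := (n : ℝ) ^ (1 / d) with hy
  have hy1 : 1 ≤ y := Real.one_le_rpow hn1 (by positivity)
  obtain ⟨J, hJ, hJ'⟩ := exists_nat_pow_near hy1 (one_lt_two (α := ℝ))
  obtain ⟨A, hAp, hAe⟩ := hA n (by omega) J
  refine ⟨A, hAp, fun X => (hAe X).trans (ENNReal.ofReal_le_ofReal ?_)⟩
  have hJlog : (J : ℝ) + 1 ≤ 3 * Real.log n := by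
    have h3 : (J : ℝ) * Real.log 2 ≤ 1 / d * Real.log n := by
      rw [← Real.log_pow, ← Real.log_rpow hn0]
      exact Real.log_le_log (by positivity) hJ
    have h4 : 1 / d * Real.log n ≤ Real.log n := by
      refine mul_le_of_le_one_left (by linarith) ?_
      rw [div_le_one hd0]; exact hd1
    have h5 := Real.log_two_gt_d9
    nlinarith [Nat.cast_nonneg (α := ℝ) J]
  have hsplit : (n : ℝ) ^ (-s) = (n : ℝ) ^ (t - s) * (n : ℝ) ^ (-t) := by
    rw [← Real.rpow_add hn0]; congr 1; ring
  have hfirst : 2 / (2 : ℝ) ^ J ≤ 4 * (n : ℝ) ^ (-t) := by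
    have h3 : (n : ℝ) ^ (-t) * y ≥ 1 := by
      rw [hy, ← Real.rpow_add hn0]
      exact Real.one_le_rpow hn1 (by linarith)
    rw [div_le_iff₀ (by positivity)]
    rw [pow_succ] at hJ'
    have h4 : 0 < (n : ℝ) ^ (-t) := by positivity
    nlinarith
  have hpow : ((2 : ℝ) ^ J) ^ (d + η - 1) / n ≤ (n : ℝ) ^ (-t) := by
    rw [div_le_iff₀ hn0]
    calc ((2 : ℝ) ^ J) ^ (d + η - 1) ≤ y ^ (d + η - 1) :=
          Real.rpow_le_rpow (by positivity) hJ (by linarith)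
      _ = (n : ℝ) ^ (-t) * n := by
          rw [hy, ← Real.rpow_mul hn0.le, ← Real.rpow_add_one hn0.ne']
          congr 1
          rw [hη]; field_simp; ring
  calc 2 / 2 ^ J + K * (J + 1) ^ 3 / n * ((2 : ℝ) ^ J) ^ (d + η - 1)
      = 2 / 2 ^ J + K * (J + 1) ^ 3 * (((2 : ℝ) ^ J) ^ (d + η - 1) / n) := by ring
    _ ≤ 4 * (n : ℝ) ^ (-t) + K * (3 * Real.log n) ^ 3 * (n : ℝ) ^ (-t) := by gcongr
    _ = (4 + K * (3 * Real.log n) ^ 3) * (n : ℝ) ^ (-t) := by ring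
    _ ≤ _ := by rw [hsplit]; gcongr

end Asymptotics

lemma log_ofReal_natCast_rpow {n : ℕ} (hn : n ≠ 0) (s : ℝ) :
    ENNReal.log (ENNReal.ofReal ((n : ℝ) ^ s)) = ((s * Real.log n : ℝ) : EReal) := by
  have hn0 : (0 : ℝ) < n := by positivity
  rw [ENNReal.log_ofReal_of_pos (by positivity), Real.log_rpow hn0]

end SyntheticPrivacy

end

/-! ### The limit. -/

theorem mainTheorem4 :
    ∃ c : ℝ, 0 < c ∧
      ∀ (T : Type*) [MetricSpace T] [CompactSpace T] [MeasurableSpace T] [BorelSpace T] (d : ℝ),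
        1 ≤ d → SyntheticPrivacy.HasMinkowskiDim T d →
        ∀ ε : ℝ, 0 < ε → ε < c →
          Tendsto (fun n : ℕ => SyntheticPrivacy.minimaxLogError T ε n) atTop
            (𝓝 ((-(1 / d) : ℝ) : EReal)) := by
  open SyntheticPrivacy in
  -- The constant `c = 1` serves only the upper bound, where it keeps the noise parameter at most
  -- `1`.
  refine ⟨1, one_pos, fun T _ _ _ _ d hd1 hd ε hε hε1 => tendsto_order.2 ⟨fun b hb => ?_, fun b hb => ?_⟩⟩
  · obtain ⟨s, hbs, hs⟩ := EReal.lt_iff_exists_real_btwn.1 hb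
    rw [EReal.coe_lt_coe_iff] at hs
    filter_upwards [eventually_le_expectedError hd1 hd hε (s := -s) (by linarith),
      eventually_ge_atTop 2] with n hn hn2
    refine hbs.trans_le (le_iInf₂ fun A hA => ?_)
    obtain ⟨X, hX⟩ := hn A hA
    refine le_iSup_of_le X ?_
    have hlog : 0 < Real.log n := Real.log_pos (by exact_mod_cast hn2)
    rw [EReal.le_div_iff_mul_le (by exact_mod_cast hlog) (EReal.coe_ne_top _), ← EReal.coe_mul,
      ← log_ofReal_natCast_rpow (by omega)]
    rw [neg_neg] at hX
    exact ENNReal.log_monotone hX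
  · obtain ⟨s, hs, hsb⟩ := EReal.lt_iff_exists_real_btwn.1 hb
    rw [EReal.coe_lt_coe_iff] at hs
    filter_upwards [eventually_expectedError_le hd1 hd hε hε1.le (s := -s) (by linarith),
      eventually_ge_atTop 2] with n hn hn2
    obtain ⟨A, hA, hAe⟩ := hn
    refine (iInf₂_le_of_le A hA (iSup_le fun X => ?_)).trans_lt hsb
    have hlog : 0 < Real.log n := Real.log_pos (by exact_mod_cast hn2)
    rw [EReal.div_le_iff_le_mul (by exact_mod_cast hlog) (EReal.coe_ne_top _), ← EReal.coe_mul,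
      mul_comm, ← log_ofReal_natCast_rpow (by omega)]
    have := hAe X
    rw [neg_neg] at this
    exact ENNReal.log_monotone this
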